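/- Write $q=q_1+q_2\boldsymbol i+q_3\boldsymbol j+q_4\boldsymbol k\in\mathbb H\cong\mathbb R^4$ and let $T^*\mathbb H_0=(\mathbb H\setminus\{0\})\times\mathbb H$, with points $(q,p)$, and $T^*\mathbb R^3_0=(\mathbb R^3\setminus\{0\})\times\mathbb R^3$, with points $(x,y)$, carry the standard symplectic forms $\Omega=\sum_j dq_j\wedge dp_j$ and $\sum_j dx_j\wedge dy_j$. Put $$\Xi_0=p_1q_4-p_4q_1+p_2q_3-p_3q_2,\qquad \Xi_1=p_1q_4-p_4q_1+p_3q_2-p_2q_3$$ (the twin-bilinear and the bilinear function), $\mathcal J_0^i=\Xi_i^{-1}(0)\subset T^*\mathbb H_0$, and let $S^1=\mathbb R/2\pi\mathbb Z$ act on $T^*\mathbb H_0$ by $\chi_i(\alpha,q,p)=(R^i_\alpha q,R^i_\alpha p)$, where $$R^0_\alpha=\begin{pmatrix}\cos\alpha&0&0&-\sin\alpha\\0&\cos\alpha&-\sin\alpha&0\\0&\sin\alpha&\cos\alpha&0\\ \sin\alpha&0&0&\cos\alpha\end{pmatrix},\qquad R^1_\alpha=\begin{pmatrix}\cos\alpha&0&0&-\sin\alpha\\0&\cos\alpha&\sin\alpha&0\\0&-\sin\alpha&\cos\alpha&0\\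 \sin\alpha&0&0&\cos\alpha\end{pmatrix}.$$ Let $\mathcal{KS}^{0}$ be the quaternionic Kustaanheimo-Stiefel map $$x=q^*\boldsymbol k\,q,\qquad y=\frac{q^*\boldsymbol k\,p}{2\,q^*q},$$ and let $\mathcal{KS}^{1}$ be the original one, $$x=L(q)q,\quad y=\frac{L(q)p}{2|q|^2},\qquad L(q)=\begin{pmatrix}q_1&-q_2&-q_3&q_4\\q_2&q_1&-q_4&-q_3\\q_3&q_4&q_1&q_2\\q_4&-q_3&q_2&-q_1\end{pmatrix}.$$ Here $\mathbb R^3\subset\mathbb R^4$ is the set of vectors $(0,x_1,x_2,x_3)$ for $i=0$ and $(x_1,x_2,x_3,0)$ for $i=1$. **Proposition.** Let $i\in\{0,1\}$. The set $\mathcal J_0^i$ is $\chi_i$-invariant, and $\mathcal{KS}^{i}$ is constant on the $\chi_i$-orbits in $\mathcal J_0^i$. On $\mathcal J_0^i$ the action is free and $d\Xi_i\neq0$, and the quotient $\mathcal J_0^i/S^1$ is a symplectic manifold, the regular reduced space: it has a smooth structure and a symplectic form $\omega_{\mathrm{red}}$ such that the projection $\pi:\mathcal J_0^i\to\mathcal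 J_0^i/S^1$ is a smooth submersion and $\pi^*\omega_{\mathrm{red}}=\Omega|_{\mathcal J_0^i}$. For any such structure, the restriction of $\mathcal{KS}^{i}$ to $\mathcal J_0^i$ takes values in $T^*\mathbb R^3_0$ and induces a symplectomorphism (a diffeomorphism that pulls the standard form back to $\omega_{\mathrm{red}}$) from $\mathcal J_0^i/S^1$ onto $T^*\mathbb R^3_0$. -/

import Mathlib

open scoped Manifold ContDiff Quaternion RealInnerProductSpace Matrix

noncomputable section

namespace KS

/-- The quaternion `q₁ + q₂ i + q₃ j + q₄ k` as the vector `(q₁, q₂, q₃, q₄)`. -/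
def coords (q : ℍ[ℝ]) : Fin 4 → ℝ := ![q.re, q.imI, q.imJ, q.imK]

/-- The vector `(v₁, v₂, v₃, v₄)` as the quaternion `v₁ + v₂ i + v₃ j + v₄ k`. -/
def ofCoords (v : Fin 4 → ℝ) : ℍ[ℝ] := ⟨v 0, v 1, v 2, v 3⟩

/-- The quaternion unit `k`. -/
def unitK : ℍ[ℝ] := ⟨0, 0, 0, 1⟩

/-- The quaternionic form of the Kustaanheimo-Stiefel map:
`x = q* k q`, `y = q* k p / (2 q* q)`. -/
def ksQuaternionic (z : ℍ[ℝ] × ℍ[ℝ]) : ℍ[ℝ] × ℍ[ℝ] :=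
  (star z.1 * unitK * z.1, (star z.1 * unitK * z.2) / (2 * (star z.1 * z.1)))

/-- The matrix `L(q)` of Kustaanheimo and Stiefel. -/
def ksMatrix (q : ℍ[ℝ]) : Matrix (Fin 4) (Fin 4) ℝ :=
  !![q.re, -q.imI, -q.imJ, q.imK;
     q.imI, q.re, -q.imK, -q.imJ;
     q.imJ, q.imK, q.re, q.imI;
     q.imK, -q.imJ, q.imI, -q.re]

/-- The original form of the Kustaanheimo-Stiefel map:
`x = L(q) q`, `y = L(q) p / (2 |q|²)`. -/
def ksOriginal (z : ℍ[ℝ] × ℍ[ℝ]) : ℍ[ℝ] × ℍ[ℝ] :=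
  (ofCoords (ksMatrix z.1 *ᵥ coords z.1),
    (2 * ‖z.1‖ ^ 2)⁻¹ • ofCoords (ksMatrix z.1 *ᵥ coords z.2))

/-- The form of the `KS` map that belongs to the action `χ_i`: the quaternionic one for `i = 0`,
the original one for `i = 1`. Only its values at points with `q ≠ 0` matter. -/
def ksMap (i : Fin 2) : ℍ[ℝ] × ℍ[ℝ] → ℍ[ℝ] × ℍ[ℝ] :=
  if i = 0 then ksQuaternionic else ksOriginal

/-- The twin-bilinear function `Ξ₀` and the bilinear function `Ξ₁`. -/
def Xi (i : Fin 2) (z : ℍ[ℝ] × ℍ[ℝ]) : ℝ :=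
  if i = 0 then
    z.2.re * z.1.imK - z.2.imK * z.1.re + z.2.imI * z.1.imJ - z.2.imJ * z.1.imI
  else
    z.2.re * z.1.imK - z.2.imK * z.1.re + z.2.imJ * z.1.imI - z.2.imI * z.1.imJ

/-- The rotation matrices `R_α^0` and `R_α^1`. -/
def rotMatrix (i : Fin 2) (α : Real.Angle) : Matrix (Fin 4) (Fin 4) ℝ :=
  if i = 0 then
    !![α.cos, 0, 0, -α.sin;
       0, α.cos, -α.sin, 0;
       0, α.sin, α.cos, 0;
       α.sin, 0, 0, α.cos]
  else
    !![α.cos, 0, 0, -α.sin;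
       0, α.cos, α.sin, 0;
       0, -α.sin, α.cos, 0;
       α.sin, 0, 0, α.cos]

/-- The rotation `q ↦ R_α^i q`. -/
def rot (i : Fin 2) (α : Real.Angle) (q : ℍ[ℝ]) : ℍ[ℝ] :=
  ofCoords (rotMatrix i α *ᵥ coords q)

/-- The action `χ_i` of the circle `S¹ = ℝ / 2πℤ`. -/
def chi (i : Fin 2) (α : Real.Angle) (z : ℍ[ℝ] × ℍ[ℝ]) : ℍ[ℝ] × ℍ[ℝ] :=
  (rot i α z.1, rot i α z.2)

/-- The zero level `J_0^i = Ξ_i⁻¹(0)` in `T*ℍ₀ = (ℍ ∖ {0}) × ℍ`. -/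
def zeroLevel (i : Fin 2) : Set (ℍ[ℝ] × ℍ[ℝ]) := {z | z.1 ≠ 0 ∧ Xi i z = 0}

/-- The tangent space of `J_0^i` at `z`, that is, the kernel of `dΞ_i(z)`. -/
def levelTangent (i : Fin 2) (z : ℍ[ℝ] × ℍ[ℝ]) : Submodule ℝ (ℍ[ℝ] × ℍ[ℝ]) :=
  LinearMap.ker (fderiv ℝ (Xi i) z : ℍ[ℝ] × ℍ[ℝ] →ₗ[ℝ] ℝ)

theorem rot_zero (i : Fin 2) (q : ℍ[ℝ]) : rot i 0 q = q := by
  fin_cases i <;>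
    ext <;> simp [rot, rotMatrix, ofCoords, coords, Matrix.mulVec, dotProduct, Fin.sum_univ_four]

theorem rot_add (i : Fin 2) (α β : Real.Angle) (q : ℍ[ℝ]) :
    rot i (α + β) q = rot i α (rot i β q) := by
  fin_cases i <;>
    ext <;> simp [rot, rotMatrix, ofCoords, coords, Matrix.mulVec, dotProduct, Fin.sum_univ_four,
      Real.Angle.cos_add, Real.Angle.sin_add] <;> ring

theorem chi_zero (i : Fin 2) (z : ℍ[ℝ] × ℍ[ℝ]) : chi i 0 z = z := by
  simp [chi, rot_zero]

theorem chi_add (i : Fin 2) (α β : Real.Angle) (z : ℍ[ℝ] × ℍ[ℝ]) :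
    chi i (α + β) z = chi i α (chi i β z) := by
  simp [chi, rot_add]

/-- Two points of `J_0^i` are equivalent when they lie on the same `χ_i`-orbit. -/
def orbitSetoid (i : Fin 2) : Setoid (zeroLevel i) where
  r z w := ∃ α : Real.Angle, chi i α z = w
  iseqv :=
    { refl := fun z => ⟨0, chi_zero i z⟩
      symm := by
        rintro z w ⟨α, h⟩
        exact ⟨-α, by rw [← h, ← chi_add, neg_add_cancel, chi_zero]⟩
      trans := by
        rintro x y z ⟨α, h⟩ ⟨β, h'⟩
        exact ⟨β + α, by rw [chi_add, h, h']⟩ }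

/-- The orbit space `J_0^i / S¹`, with the quotient topology. -/
abbrev OrbitSpace (i : Fin 2) : Type := Quotient (orbitSetoid i)

/-- The canonical projection `π : J_0^i → J_0^i / S¹`. -/
def proj (i : Fin 2) (z : zeroLevel i) : OrbitSpace i := Quotient.mk (orbitSetoid i) z

/-- The space `ℝ³ × ℝ³`, with `ℝ³` Euclidean. -/
abbrev Phase3 : Type := EuclideanSpace ℝ (Fin 3) × EuclideanSpace ℝ (Fin 3)

/-- The cotangent bundle `T*ℝ³₀ = (ℝ³ ∖ {0}) × ℝ³`, an open subset of `ℝ³ × ℝ³`. -/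
def cotangentR30 : TopologicalSpace.Opens Phase3 :=
  ⟨{z | z.1 ≠ 0}, isOpen_ne_fun continuous_fst continuous_const⟩

/-- The copy of `ℝ³` in `ℍ = ℝ⁴` that receives the `KS` map: the imaginary quaternions
`(0, v₁, v₂, v₃)` for the quaternionic form, the vectors `(v₁, v₂, v₃, 0)` for the original one. -/
def embedR3 (i : Fin 2) (v : EuclideanSpace ℝ (Fin 3)) : ℍ[ℝ] :=
  if i = 0 then ⟨0, v 0, v 1, v 2⟩ else ⟨v 0, v 1, v 2, 0⟩

/-- The standard symplectic form `Ω = -d⟨p, dq⟩ = ∑ dq_j ∧ dp_j` on `F × F ≅ T*F`, at any point. -/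
def stdForm {F : Type*} [NormedAddCommGroup F] [InnerProductSpace ℝ F] (v w : F × F) : ℝ :=
  ⟪v.1, w.2⟫ - ⟪v.2, w.1⟫

section Forms

variable {E : Type*} [NormedAddCommGroup E] [NormedSpace ℝ E]
  {M : Type*} [TopologicalSpace M] [ChartedSpace E M]

/-- The expression of a 2-form in a chart `e`, i.e. its pullback by `e⁻¹`. -/
def localForm (σ : ∀ x : M, TangentSpace 𝓘(ℝ, E) x [⋀^Fin 2]→L[ℝ] ℝ)
    (e : OpenPartialHomeomorph M E) (u : E) : E [⋀^Fin 2]→L[ℝ] ℝ :=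
  (σ (e.symm u)).compContinuousLinearMap (mfderiv 𝓘(ℝ, E) 𝓘(ℝ, E) e.symm u)

/-- A symplectic form on a manifold modelled on `E`: a smooth, closed, nondegenerate 2-form. -/
structure IsSymplecticForm (σ : ∀ x : M, TangentSpace 𝓘(ℝ, E) x [⋀^Fin 2]→L[ℝ] ℝ) : Prop where
  smooth : ∀ e ∈ atlas E M, ContDiffOn ℝ ∞ (localForm σ e) e.target
  closed : ∀ e ∈ atlas E M, ∀ u ∈ e.target, extDeriv (localForm σ e) u = 0
  nondegenerate : ∀ (x : M) (ξ : TangentSpace 𝓘(ℝ, E) x),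
    (∀ η : TangentSpace 𝓘(ℝ, E) x, σ x ![ξ, η] = 0) → ξ = 0

end Forms

/-- `F` is a smooth extension, to a neighbourhood of `z` in `ℍ × ℍ`, of the projection `π`. -/
def IsSmoothExtension (i : Fin 2) [ChartedSpace Phase3 (OrbitSpace i)] (z : zeroLevel i)
    (F : ℍ[ℝ] × ℍ[ℝ] → OrbitSpace i) : Prop :=
  ∃ U : Set (ℍ[ℝ] × ℍ[ℝ]), IsOpen U ∧ (z : ℍ[ℝ] × ℍ[ℝ]) ∈ U ∧
    ContMDiffOn 𝓘(ℝ, ℍ[ℝ] × ℍ[ℝ]) 𝓘(ℝ, Phase3) ∞ F U ∧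
    ∀ w : zeroLevel i, (w : ℍ[ℝ] × ℍ[ℝ]) ∈ U → F w = proj i w

/-- A 6-dimensional manifold structure and a 2-form `σ` on `J_0^i / S¹` make it the
(Marsden-Weinstein) reduced space: the structure is smooth, `σ` is symplectic, `π` is a smooth
submersion, and `π* σ` is the restriction of `Ω` to `J_0^i`. A map on `J_0^i` is smooth when it
extends smoothly near each point; its differential at `z` is the restriction to the tangent space
of `J_0^i` of the differential of any extension. -/
structure IsReducedSpace (i : Fin 2) [ChartedSpace Phase3 (OrbitSpace i)]
    (σ : ∀ x : OrbitSpace i, TangentSpace 𝓘(ℝ, Phase3) x [⋀^Fin 2]→L[ℝ] ℝ) : Prop where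
  isManifold : IsManifold 𝓘(ℝ, Phase3) ∞ (OrbitSpace i)
  isSymplecticForm : IsSymplecticForm σ
  proj_smooth : ∀ z : zeroLevel i, ∃ F, IsSmoothExtension i z F
  proj_submersion : ∀ (z : zeroLevel i) (F), IsSmoothExtension i z F →
    ∀ ξ : TangentSpace 𝓘(ℝ, Phase3) (F z), ∃ v ∈ levelTangent i z,
      mfderiv 𝓘(ℝ, ℍ[ℝ] × ℍ[ℝ]) 𝓘(ℝ, Phase3) F z v = ξ
  proj_pullback : ∀ (z : zeroLevel i) (F), IsSmoothExtension i z F →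
    ∀ v ∈ levelTangent i z, ∀ w ∈ levelTangent i z,
      σ (F z) ![mfderiv 𝓘(ℝ, ℍ[ℝ] × ℍ[ℝ]) 𝓘(ℝ, Phase3) F z v,
        mfderiv 𝓘(ℝ, ℍ[ℝ] × ℍ[ℝ]) 𝓘(ℝ, Phase3) F z w] = stdForm v w

end KS

end

open KS

section

open scoped Topology
open Filter Set

noncomputable section

namespace KS

/-! Write J for `twist i`, the generator of the rotations: it is orthogonal, J² = -1 and Ξ = -⟨Jq,
p⟩. The map has the form x = B(q, q), y = B(q, p) / (2|q|²), where B = `bil i` is symmetric,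
rotation-invariant and ℝ³-valued; the remaining coordinate of the original formulas vanishes where Ξ
does. For q ≠ 0, B(q, ·) has kernel ℝJq and is |q| times an isometry from the orthogonal complement
of Jq onto ℝ³ (`inner_bil_bil`, `adj_bil`, `bil_adj`).

Hence |x| = |q|², and on the zero level q and y determine p (`snd_eq_of_mem_zeroLevel`). By
`adj_bil_self`, x determines q up to rotation, so the fibres are exactly the orbits. The smooth
sections `localSection` make the induced map `orbitMap` a homeomorphism onto {x ≠ 0}, and
`stdForm_fderiv_ksVec` shows that the standard form pulls back to Ω on the tangent spaces of the
level.

A reduced structure exists: transport the standard one through `orbitMap`. For an arbitrary reduced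
structure, the inverse of `orbitMap` is locally an extension of π composed with a section, hence
smooth and symplectic. Its differential is then injective, and the inverse function theorem makes
`orbitMap` smooth. -/

/-- The quaternion with the given coordinates. -/
def quat (a b c d : ℝ) : ℍ[ℝ] := ⟨a, b, c, d⟩

@[simp] theorem quat_re (a b c d : ℝ) : (quat a b c d).re = a := rfl
@[simp] theorem quat_imI (a b c d : ℝ) : (quat a b c d).imI = b := rfl
@[simp] theorem quat_imJ (a b c d : ℝ) : (quat a b c d).imJ = c := rfl
@[simp] theorem quat_imK (a b c d : ℝ) : (quat a b c d).imK = d := rfl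

theorem inner_quaternion_eq (a b : ℍ[ℝ]) :
    ⟪a, b⟫ = a.re * b.re + a.imI * b.imI + a.imJ * b.imJ + a.imK * b.imK := by
  rw [Quaternion.inner_def]
  simp

theorem inner_euclidean_three_eq (x y : EuclideanSpace ℝ (Fin 3)) :
    ⟪x, y⟫ = x 0 * y 0 + x 1 * y 1 + x 2 * y 2 := by
  simp [PiLp.inner_apply, Fin.sum_univ_three]
  ring

/-! ### The bilinear map, its transpose and the circle generator -/

/-- The symmetric bilinear map `ℍ × ℍ → ℝ³` whose quadratic form is the configuration part
of the `KS` map. -/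
def bil (i : Fin 2) : ℍ[ℝ] →L[ℝ] ℍ[ℝ] →L[ℝ] EuclideanSpace ℝ (Fin 3) :=
  (LinearMap.mk₂ ℝ (fun q p : ℍ[ℝ] =>
    if i = 0 then
      !₂[-(q.imJ * p.re) + q.imK * p.imI - q.re * p.imJ + q.imI * p.imK,
        q.imI * p.re + q.re * p.imI + q.imK * p.imJ + q.imJ * p.imK,
        q.re * p.re - q.imI * p.imI - q.imJ * p.imJ + q.imK * p.imK]
    else
      !₂[q.re * p.re - q.imI * p.imI - q.imJ * p.imJ + q.imK * p.imK,
        q.imI * p.re + q.re * p.imI - q.imK * p.imJ - q.imJ * p.imK,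
        q.imJ * p.re + q.imK * p.imI + q.re * p.imJ + q.imI * p.imK])
    (by intro a b c; ext j; fin_cases i <;> fin_cases j <;> simp <;> ring)
    (by intro r a b; ext j; fin_cases i <;> fin_cases j <;> simp <;> ring)
    (by intro a b c; ext j; fin_cases i <;> fin_cases j <;> simp <;> ring)
    (by intro r a b; ext j; fin_cases i <;> fin_cases j <;> simp <;> ring)).toContinuousBilinearMap

theorem bil_zero_apply (q p : ℍ[ℝ]) : bil 0 q p =
    !₂[-(q.imJ * p.re) + q.imK * p.imI - q.re * p.imJ + q.imI * p.imK,
      q.imI * p.re + q.re * p.imI + q.imK * p.imJ + q.imJ * p.imK,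
      q.re * p.re - q.imI * p.imI - q.imJ * p.imJ + q.imK * p.imK] := rfl

theorem bil_one_apply (q p : ℍ[ℝ]) : bil 1 q p =
    !₂[q.re * p.re - q.imI * p.imI - q.imJ * p.imJ + q.imK * p.imK,
      q.imI * p.re + q.re * p.imI - q.imK * p.imJ - q.imJ * p.imK,
      q.imJ * p.re + q.imK * p.imI + q.re * p.imJ + q.imI * p.imK] := rfl

/-- The transpose of `bil i q`. -/
def adj (i : Fin 2) : ℍ[ℝ] →L[ℝ] EuclideanSpace ℝ (Fin 3) →L[ℝ] ℍ[ℝ] :=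
  (LinearMap.mk₂ ℝ (fun (q : ℍ[ℝ]) (y : EuclideanSpace ℝ (Fin 3)) =>
    if i = 0 then
      (quat (q.re * y 2 + q.imI * y 1 - q.imJ * y 0)
        (-(q.imI * y 2) + q.re * y 1 + q.imK * y 0)
        (-(q.imJ * y 2) + q.imK * y 1 - q.re * y 0)
        (q.imK * y 2 + q.imJ * y 1 + q.imI * y 0))
    else
      quat (q.re * y 0 + q.imI * y 1 + q.imJ * y 2)
        (-(q.imI * y 0) + q.re * y 1 + q.imK * y 2)
        (-(q.imJ * y 0) - q.imK * y 1 + q.re * y 2)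
        (q.imK * y 0 - q.imJ * y 1 + q.imI * y 2))
    (by intro a b c; fin_cases i <;> ext <;> simp <;> ring)
    (by intro r a b; fin_cases i <;> ext <;> simp <;> ring)
    (by intro a b c; fin_cases i <;> ext <;> simp <;> ring)
    (by intro r a b; fin_cases i <;> ext <;> simp <;> ring)).toContinuousBilinearMap

theorem adj_zero_apply (q : ℍ[ℝ]) (y : EuclideanSpace ℝ (Fin 3)) : adj 0 q y =
    quat (q.re * y 2 + q.imI * y 1 - q.imJ * y 0)
        (-(q.imI * y 2) + q.re * y 1 + q.imK * y 0)
        (-(q.imJ * y 2) + q.imK * y 1 - q.re * y 0)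
        (q.imK * y 2 + q.imJ * y 1 + q.imI * y 0) := rfl

theorem adj_one_apply (q : ℍ[ℝ]) (y : EuclideanSpace ℝ (Fin 3)) : adj 1 q y =
    quat (q.re * y 0 + q.imI * y 1 + q.imJ * y 2)
        (-(q.imI * y 0) + q.re * y 1 + q.imK * y 2)
        (-(q.imJ * y 0) - q.imK * y 1 + q.re * y 2)
        (q.imK * y 0 - q.imJ * y 1 + q.imI * y 2) := rfl

/-- The rotation `R_{π/2}^i`, the infinitesimal generator of the action. -/
def twist (i : Fin 2) : ℍ[ℝ] →L[ℝ] ℍ[ℝ] :=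
  LinearMap.toContinuousLinearMap
    { toFun := fun q : ℍ[ℝ] =>
        if i = 0 then (quat (-q.imK) (-q.imJ) q.imI q.re) else quat (-q.imK) q.imJ (-q.imI) q.re
      map_add' := by intro a b; fin_cases i <;> ext <;> simp <;> ring
      map_smul' := by intro r a; fin_cases i <;> ext <;> simp }

theorem twist_zero_apply (q : ℍ[ℝ]) : twist 0 q = quat (-q.imK) (-q.imJ) q.imI q.re := rfl

theorem twist_one_apply (q : ℍ[ℝ]) : twist 1 q = quat (-q.imK) q.imJ (-q.imI) q.re := rfl

theorem Xi_eq_inner (i : Fin 2) (z : ℍ[ℝ] × ℍ[ℝ]) : Xi i z = -⟪twist i z.1, z.2⟫ := by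
  rw [inner_quaternion_eq]
  fin_cases i <;> simp [Xi, twist_zero_apply, twist_one_apply] <;> ring

theorem rot_eq (i : Fin 2) (α : Real.Angle) (q : ℍ[ℝ]) :
    rot i α q = α.cos • q + α.sin • twist i q := by
  fin_cases i <;> ext <;>
    simp [rot, rotMatrix, ofCoords, coords, Matrix.mulVec, dotProduct, Fin.sum_univ_four,
      twist_zero_apply, twist_one_apply] <;> ring

theorem bil_comm (i : Fin 2) (q p : ℍ[ℝ]) : bil i q p = bil i p q := by
  ext j
  fin_cases i <;> fin_cases j <;> simp [bil_zero_apply, bil_one_apply] <;> ring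

/-- Infinitesimal form of the rotation invariance of B. -/
theorem bil_twist_right (i : Fin 2) (q p : ℍ[ℝ]) : bil i q (twist i p) = -bil i (twist i q) p := by
  ext j
  fin_cases i <;> fin_cases j <;>
    simp [bil_zero_apply, bil_one_apply, twist_zero_apply, twist_one_apply] <;> ring

theorem twist_twist (i : Fin 2) (q : ℍ[ℝ]) : twist i (twist i q) = -q := by
  fin_cases i <;> ext <;> simp [twist_zero_apply, twist_one_apply]

theorem inner_twist_twist (i : Fin 2) (q p : ℍ[ℝ]) : ⟪twist i q, twist i p⟫ = ⟪q, p⟫ := by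
  simp only [inner_quaternion_eq]
  fin_cases i <;> simp [twist_zero_apply, twist_one_apply] <;> ring

theorem inner_twist_self (i : Fin 2) (q : ℍ[ℝ]) : ⟪twist i q, q⟫ = 0 := by
  simp only [inner_quaternion_eq]
  fin_cases i <;> simp [twist_zero_apply, twist_one_apply] <;> ring

theorem inner_twist_left (i : Fin 2) (q p : ℍ[ℝ]) : ⟪twist i q, p⟫ = -⟪q, twist i p⟫ := by
  simp only [inner_quaternion_eq]
  fin_cases i <;> simp [twist_zero_apply, twist_one_apply] <;> ring

/-- The coordinates of B(q, a), together with -⟨Jq, a⟩, are those of q* k a or of L(q)a, and both of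
these are |q| times an isometry of ℝ⁴ in a. -/
theorem inner_bil_bil (i : Fin 2) (q a b : ℍ[ℝ]) : ⟪bil i q a, bil i q b⟫ =
    ⟪q, q⟫ * ⟪a, b⟫ - ⟪twist i q, a⟫ * ⟪twist i q, b⟫ := by
  simp only [inner_quaternion_eq, inner_euclidean_three_eq]
  fin_cases i <;>
    simp [bil_zero_apply, bil_one_apply, twist_zero_apply, twist_one_apply] <;> ring

/-- The terms that differentiating B(q, p) in q adds to the pulled back symplectic form. Apart from
the first two summands, everything on the right involves Jq and is removed by the constraint and the
tangency equations. -/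
theorem inner_bil_bil_sub (i : Fin 2) (q p a b : ℍ[ℝ]) :
    ⟪bil i q a, bil i b p⟫ - ⟪bil i q b, bil i a p⟫ =
      2 * ⟪q, b⟫ * ⟪a, p⟫ - 2 * ⟪q, a⟫ * ⟪b, p⟫
        - ⟪twist i q, a⟫ * ⟪twist i b, p⟫ + ⟪twist i q, b⟫ * ⟪twist i a, p⟫
        + 2 * ⟪twist i q, p⟫ * ⟪twist i a, b⟫ := by
  simp only [inner_quaternion_eq, inner_euclidean_three_eq]
  fin_cases i <;>
    simp [bil_zero_apply, bil_one_apply, twist_zero_apply, twist_one_apply] <;> ring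

theorem bil_adj (i : Fin 2) (q : ℍ[ℝ]) (y : EuclideanSpace ℝ (Fin 3)) :
    bil i q (adj i q y) = ⟪q, q⟫ • y := by
  simp only [inner_quaternion_eq]
  ext j
  fin_cases i <;> fin_cases j <;>
    simp [bil_zero_apply, bil_one_apply, adj_zero_apply, adj_one_apply] <;> ring

theorem inner_twist_adj (i : Fin 2) (q : ℍ[ℝ]) (y : EuclideanSpace ℝ (Fin 3)) :
    ⟪twist i q, adj i q y⟫ = 0 := by
  simp only [inner_quaternion_eq]
  fin_cases i <;>
    simp [twist_zero_apply, twist_one_apply, adj_zero_apply, adj_one_apply] <;> ring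

theorem adj_bil (i : Fin 2) (q p : ℍ[ℝ]) :
    adj i q (bil i q p) = ⟪q, q⟫ • p - ⟪twist i q, p⟫ • twist i q := by
  simp only [inner_quaternion_eq]
  fin_cases i <;> ext <;>
    simp [bil_zero_apply, bil_one_apply, adj_zero_apply, adj_one_apply,
      twist_zero_apply, twist_one_apply] <;> ring

/-- Recovers q₀ from q up to phase when both have the same image x. Read for fixed q₀ and varying x
= B(q, q), it also yields the local section. -/
theorem adj_bil_self (i : Fin 2) (q₀ q : ℍ[ℝ]) :
    adj i q₀ (bil i q q) + ⟪q, q⟫ • q₀ =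
      (2 * ⟪q₀, q⟫) • q - (2 * ⟪twist i q₀, q⟫) • twist i q := by
  simp only [inner_quaternion_eq]
  fin_cases i <;> ext <;>
    simp [bil_zero_apply, bil_one_apply, adj_zero_apply, adj_one_apply,
      twist_zero_apply, twist_one_apply] <;> ring

/-- The right side is |x|² times the half-turn of B(q, q) about the axis x. -/
theorem bil_adj_adj (i : Fin 2) (q : ℍ[ℝ]) (x : EuclideanSpace ℝ (Fin 3)) :
    bil i (adj i q x) (adj i q x) = (2 * ⟪bil i q q, x⟫) • x - ⟪x, x⟫ • bil i q q := by
  simp only [inner_euclidean_three_eq]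
  ext j
  fin_cases i <;> fin_cases j <;>
    simp [bil_zero_apply, bil_one_apply, adj_zero_apply, adj_one_apply] <;> ring

/-! ### The map in vector form and the circle action -/

/-- The `KS` map with values in `ℝ³ × ℝ³`, defined on all of `ℍ × ℍ`. -/
def ksVec (i : Fin 2) (z : ℍ[ℝ] × ℍ[ℝ]) : Phase3 :=
  (bil i z.1 z.1, (2 * ⟪z.1, z.1⟫)⁻¹ • bil i z.1 z.2)

theorem unitK_eq : unitK = quat 0 0 0 1 := rfl

theorem ofCoords_eq (v : Fin 4 → ℝ) : ofCoords v = quat (v 0) (v 1) (v 2) (v 3) := rfl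

theorem embedR3_zero (v : EuclideanSpace ℝ (Fin 3)) :
    embedR3 0 v = quat 0 (v 0) (v 1) (v 2) := rfl

theorem embedR3_one (v : EuclideanSpace ℝ (Fin 3)) :
    embedR3 1 v = quat (v 0) (v 1) (v 2) 0 := rfl

theorem ksQuaternionic_eq (q p : ℍ[ℝ]) : ksQuaternionic (q, p) =
    (star q * unitK * q, (2 * ⟪q, q⟫)⁻¹ • (star q * unitK * p)) := by
  have h1 : star q * q = ((⟪q, q⟫ : ℝ) : ℍ[ℝ]) := by
    rw [Quaternion.inner_self, Quaternion.star_mul_self]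
  have h2 : (2 : ℍ[ℝ]) * ((⟪q, q⟫ : ℝ) : ℍ[ℝ]) = ((2 * ⟪q, q⟫ : ℝ) : ℍ[ℝ]) := by
    rw [Quaternion.coe_mul]; rfl
  rw [ksQuaternionic, h1, h2, div_eq_mul_inv, ← Quaternion.coe_inv, Quaternion.mul_coe_eq_smul]

theorem ksOriginal_eq (q p : ℍ[ℝ]) : ksOriginal (q, p) =
    (ofCoords (ksMatrix q *ᵥ coords q),
      (2 * ⟪q, q⟫)⁻¹ • ofCoords (ksMatrix q *ᵥ coords p)) := by
  rw [ksOriginal, real_inner_self_eq_norm_sq]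

/-- The coordinate of y outside ℝ³ is Ξ / (2|q|²), so the constraint is what places the image in
T*ℝ³. -/
theorem ksMap_eq_embedR3 (i : Fin 2) {z : ℍ[ℝ] × ℍ[ℝ]} (hz : z ∈ zeroLevel i) :
    ksMap i z = (embedR3 i (ksVec i z).1, embedR3 i (ksVec i z).2) := by
  obtain ⟨q, p⟩ := z
  have hX : Xi i (q, p) = 0 := hz.2
  fin_cases i
  · change ksQuaternionic (q, p) = _
    rw [ksQuaternionic_eq]
    simp only [ksVec, Fin.zero_eta, embedR3_zero, unitK_eq]
    simp [Xi] at hX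
    generalize (2 * ⟪q, q⟫)⁻¹ = c
    refine Prod.ext ?_ ?_
    · ext <;> simp [bil_zero_apply] <;> ring
    · ext <;> simp [bil_zero_apply]
      · right; linear_combination hX
      all_goals exact Or.inl (by ring)
  · change ksOriginal (q, p) = _
    rw [ksOriginal_eq]
    simp only [ksVec, Fin.mk_one, embedR3_one, ofCoords_eq]
    simp [Xi] at hX
    generalize (2 * ⟪q, q⟫)⁻¹ = c
    refine Prod.ext ?_ ?_
    · ext <;> simp [bil_one_apply, ksMatrix, coords, Matrix.mulVec, dotProduct,
        Fin.sum_univ_four] <;> ring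
    · ext <;> simp [bil_one_apply, ksMatrix, coords, Matrix.mulVec, dotProduct,
        Fin.sum_univ_four]
      iterate 2 exact Or.inl (by ring)
      right; linear_combination hX

theorem twist_rot (i : Fin 2) (α : Real.Angle) (q : ℍ[ℝ]) :
    twist i (rot i α q) = α.cos • twist i q - α.sin • q := by
  simp [rot_eq, twist_twist, sub_eq_add_neg]

theorem inner_rot_rot (i : Fin 2) (α : Real.Angle) (q p : ℍ[ℝ]) :
    ⟪rot i α q, rot i α p⟫ = ⟪q, p⟫ := by
  simp only [rot_eq, inner_add_left, inner_add_right, real_inner_smul_left, real_inner_smul_right,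
    inner_twist_left, twist_twist, inner_neg_right]
  linear_combination ⟪q, p⟫ * α.cos_sq_add_sin_sq

/-- Skewness of J for B cancels the mixed terms and gives B(Jq, Jp) = B(q, p); then cos² + sin² = 1.
-/
theorem bil_rot_rot (i : Fin 2) (α : Real.Angle) (q p : ℍ[ℝ]) :
    bil i (rot i α q) (rot i α p) = bil i q p := by
  simp only [rot_eq, map_add, map_smul, add_apply, smul_apply,
    bil_twist_right, twist_twist, map_neg, neg_apply]
  match_scalars
  · linear_combination α.cos_sq_add_sin_sq
  all_goals ring

theorem ksVec_chi (i : Fin 2) (α : Real.Angle) (z : ℍ[ℝ] × ℍ[ℝ]) :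
    ksVec i (chi i α z) = ksVec i z := by
  simp only [ksVec, chi, bil_rot_rot, inner_rot_rot]

theorem Xi_chi (i : Fin 2) (α : Real.Angle) (z : ℍ[ℝ] × ℍ[ℝ]) : Xi i (chi i α z) = Xi i z := by
  have : twist i (rot i α z.1) = rot i α (twist i z.1) := by
    rw [twist_rot, rot_eq, twist_twist, smul_neg, sub_eq_add_neg]
  simp only [Xi_eq_inner, chi, this, inner_rot_rot]

theorem rot_ne_zero (i : Fin 2) (α : Real.Angle) {q : ℍ[ℝ]} (hq : q ≠ 0) : rot i α q ≠ 0 := by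
  rw [← inner_self_ne_zero (𝕜 := ℝ), inner_rot_rot]
  exact inner_self_ne_zero.2 hq

theorem chi_mem_zeroLevel (i : Fin 2) (α : Real.Angle) {z : ℍ[ℝ] × ℍ[ℝ]} (hz : z ∈ zeroLevel i) :
    chi i α z ∈ zeroLevel i :=
  ⟨rot_ne_zero i α hz.1, by rw [Xi_chi]; exact hz.2⟩

theorem eq_zero_of_rot_eq_self (i : Fin 2) (α : Real.Angle) {q : ℍ[ℝ]} (hq : q ≠ 0)
    (h : rot i α q = q) : α = 0 := by
  have hN : ⟪q, q⟫ ≠ 0 := inner_self_ne_zero.2 hq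
  rw [rot_eq] at h
  -- q and Jq are orthogonal of equal nonzero length, so pairing with each isolates cos α and sin α.
  have hc : α.cos = 1 := by
    have := congrArg (fun x => ⟪q, x⟫) h
    simp only [inner_add_right, real_inner_smul_right] at this
    rw [real_inner_comm (twist i q) q, inner_twist_self, mul_zero, add_zero] at this
    exact mul_right_cancel₀ hN (by rw [one_mul]; exact this)
  have hs : α.sin = 0 := by
    have := congrArg (fun x => ⟪twist i q, x⟫) h
    simp only [inner_add_right, real_inner_smul_right, inner_twist_self, inner_twist_twist] at this
    exact (mul_eq_zero.1 (by linarith : α.sin * ⟪q, q⟫ = 0)).resolve_right hN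
  induction α using Real.Angle.induction_on with
  | h a =>
    rw [← Real.Angle.coe_zero]
    exact Real.Angle.cos_sin_inj (by simpa using hc) (by simpa using hs)

/-! ### The fibres are the orbits -/

theorem inner_bil_self (i : Fin 2) (q : ℍ[ℝ]) : ⟪bil i q q, bil i q q⟫ = ⟪q, q⟫ ^ 2 := by
  rw [inner_bil_bil, inner_twist_self]; ring

theorem norm_bil_self (i : Fin 2) (q : ℍ[ℝ]) : ‖bil i q q‖ = ⟪q, q⟫ := by
  have h := inner_bil_self i q
  rw [real_inner_self_eq_norm_sq] at h
  exact (pow_left_inj₀ (norm_nonneg _) real_inner_self_nonneg two_ne_zero).1 h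

theorem bil_self_ne_zero (i : Fin 2) {q : ℍ[ℝ]} (hq : q ≠ 0) : bil i q q ≠ 0 := by
  rw [← norm_ne_zero_iff, norm_bil_self]
  exact inner_self_ne_zero.2 hq

theorem exists_angle_of_sq_add_sq {a b : ℝ} (h : a ^ 2 + b ^ 2 = 1) :
    ∃ α : Real.Angle, α.cos = a ∧ α.sin = b := by
  have hn : ‖(⟨a, b⟩ : ℂ)‖ = 1 := by
    rw [Complex.norm_def, Complex.normSq_mk, ← sq, ← sq, h, Real.sqrt_one]
  have h0 : (⟨a, b⟩ : ℂ) ≠ 0 := norm_ne_zero_iff.1 (by rw [hn]; exact one_ne_zero)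
  refine ⟨(Complex.arg ⟨a, b⟩ : ℝ), ?_, ?_⟩
  · rw [Real.Angle.cos_coe, Complex.cos_arg h0, hn, div_one]
  · rw [Real.Angle.sin_coe, Complex.sin_arg, hn, div_one]

/-- With equal images, `adj_bil_self` becomes N q₀ = c q - s Jq, where N = |q₀|² = |q|². Comparing
lengths gives c² + s² = N², so c/N and -s/N are the cosine and sine of an angle. -/
theorem exists_rot_eq_of_bil_self_eq (i : Fin 2) {q₀ q : ℍ[ℝ]} (hq₀ : q₀ ≠ 0)
    (h : bil i q₀ q₀ = bil i q q) : ∃ α : Real.Angle, rot i α q = q₀ := by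
  have hN : ⟪q₀, q₀⟫ ≠ 0 := inner_self_ne_zero.2 hq₀
  have hNN : ⟪q, q⟫ = ⟪q₀, q₀⟫ := by rw [← norm_bil_self i q, ← h, norm_bil_self]
  have key := adj_bil_self i q₀ q
  rw [← h, adj_bil, inner_twist_self, zero_smul, sub_zero, hNN] at key
  set c := ⟪q₀, q⟫
  set s := ⟪twist i q₀, q⟫
  set N := ⟪q₀, q₀⟫
  have h1 : q₀ = (c / N) • q + (-(s / N)) • twist i q := by
    have : (2 * N) • q₀ = (2 * c) • q - (2 * s) • twist i q := by
      rw [← key, two_mul, add_smul]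
    calc q₀ = (2 * N)⁻¹ • ((2 * N) • q₀) := by
          rw [smul_smul, inv_mul_cancel₀ (by positivity), one_smul]
      _ = _ := by
          rw [this]
          match_scalars <;> field_simp
  have h2 : (c / N) ^ 2 + (-(s / N)) ^ 2 = 1 := by
    have h3 : ⟪q₀, q₀⟫ = ((c / N) ^ 2 + (-(s / N)) ^ 2) * N := by
      conv_lhs => rw [h1]
      simp only [inner_add_left, inner_add_right, real_inner_smul_left, real_inner_smul_right,
        inner_twist_left, twist_twist, inner_neg_right, hNN]
      ring
    exact mul_right_cancel₀ hN (by rw [one_mul]; exact h3.symm)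
  obtain ⟨α, hc, hs⟩ := exists_angle_of_sq_add_sq h2
  exact ⟨α, by rw [rot_eq, hc, hs, ← h1]⟩

/-- The constraint says that p is orthogonal to Jq, and there the transpose of B(q, ·) inverts it up
to the factor |q|². -/
theorem snd_eq_of_mem_zeroLevel (i : Fin 2) {z : ℍ[ℝ] × ℍ[ℝ]} (hz : z ∈ zeroLevel i) :
    z.2 = (2 : ℝ) • adj i z.1 (ksVec i z).2 := by
  have hN : ⟪z.1, z.1⟫ ≠ 0 := inner_self_ne_zero.2 hz.1
  have hX : ⟪twist i z.1, z.2⟫ = 0 := by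
    have := hz.2
    rw [Xi_eq_inner] at this
    linarith
  simp only [ksVec, map_smul, adj_bil, hX, zero_smul, sub_zero, smul_smul]
  rw [show 2 * ((2 * ⟪z.1, z.1⟫)⁻¹ * ⟪z.1, z.1⟫) = 1 by field_simp, one_smul]

theorem exists_chi_eq_of_ksVec_eq (i : Fin 2) {z w : ℍ[ℝ] × ℍ[ℝ]} (hz : z ∈ zeroLevel i)
    (hw : w ∈ zeroLevel i) (h : ksVec i z = ksVec i w) : ∃ α : Real.Angle, chi i α z = w := by
  obtain ⟨α, hα⟩ := exists_rot_eq_of_bil_self_eq i hw.1 (congrArg Prod.fst h).symm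
  refine ⟨α, Prod.ext hα ?_⟩
  have h1 : (chi i α z).1 = w.1 := hα
  rw [snd_eq_of_mem_zeroLevel i (chi_mem_zeroLevel i α hz), snd_eq_of_mem_zeroLevel i hw, h1,
    ksVec_chi, h]

/-! ### Local sections -/

/-- The local section of the `KS` map through a point of `J_0^i` with position `q₀`. -/
def localSection (i : Fin 2) (q₀ : ℍ[ℝ]) (w : Phase3) : ℍ[ℝ] × ℍ[ℝ] :=
  let q := (√(2 * (‖w.1‖ * ⟪q₀, q₀⟫ + ⟪bil i q₀ q₀, w.1⟫)))⁻¹ • (‖w.1‖ • q₀ + adj i q₀ w.1)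
  (q, (2 : ℝ) • adj i q w.2)

/-- The domain of `localSection i q₀`. -/
def sectionDomain (i : Fin 2) (q₀ : ℍ[ℝ]) : Set Phase3 :=
  {w | 0 < ‖w.1‖ * ⟪q₀, q₀⟫ + ⟪bil i q₀ q₀, w.1⟫}

/-- The formula selects the preimage q of x with ⟨Jq₀, q⟩ = 0 and ⟨q₀, q⟩ > 0: then `adj_bil_self`
reads |x|q₀ + adj(q₀, x) = 2⟨q₀, q⟩q, and pairing with q₀ shows that (2⟨q₀, q⟩)² is the number under
the root. -/
theorem bil_localSection_fst (i : Fin 2) {q₀ : ℍ[ℝ]} {w : Phase3} (hw : w ∈ sectionDomain i q₀) :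
    bil i (localSection i q₀ w).1 (localSection i q₀ w).1 = w.1 := by
  obtain ⟨x, y⟩ := w
  simp only [sectionDomain, mem_ofPred_eq] at hw
  simp only [localSection]
  set r := ‖x‖
  set D := r * ⟪q₀, q₀⟫ + ⟪bil i q₀ q₀, x⟫ with hD
  have hs : (√(2 * D))⁻¹ * (√(2 * D))⁻¹ = (2 * D)⁻¹ := by
    rw [← mul_inv, Real.mul_self_sqrt (by positivity)]
  have hr : ⟪x, x⟫ = r ^ 2 := real_inner_self_eq_norm_sq x
  have h : bil i (r • q₀ + adj i q₀ x) (r • q₀ + adj i q₀ x) = (2 * D) • x := by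
    simp only [map_add, map_smul, add_apply, smul_apply,
      bil_comm i (adj i q₀ x) q₀, bil_adj, bil_adj_adj, hr]
    rw [hD]
    module
  simp only [map_smul, smul_apply, h, smul_smul]
  rw [← mul_assoc, hs, inv_mul_cancel₀ (by positivity), one_smul]

theorem localSection_mem_zeroLevel (i : Fin 2) {q₀ : ℍ[ℝ]} {w : Phase3}
    (hw : w ∈ sectionDomain i q₀) : localSection i q₀ w ∈ zeroLevel i := by
  have h := bil_localSection_fst i hw
  refine ⟨fun h0 => ?_, ?_⟩
  · rw [h0, map_zero] at h
    simp [sectionDomain, ← h] at hw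
  · rw [Xi_eq_inner]
    simp only [localSection, real_inner_smul_right]
    rw [inner_twist_adj]; simp

theorem ksVec_localSection (i : Fin 2) {q₀ : ℍ[ℝ]} {w : Phase3} (hw : w ∈ sectionDomain i q₀) :
    ksVec i (localSection i q₀ w) = w := by
  refine Prod.ext (bil_localSection_fst i hw) ?_
  have hN : ⟪(localSection i q₀ w).1, (localSection i q₀ w).1⟫ ≠ 0 :=
    inner_self_ne_zero.2 (localSection_mem_zeroLevel i hw).1
  have h2 : (localSection i q₀ w).2 = (2 : ℝ) • adj i (localSection i q₀ w).1 w.2 := rfl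
  simp only [ksVec]
  rw [h2, map_smul, bil_adj, smul_smul, smul_smul]
  rw [mul_assoc, inv_mul_cancel₀ (by positivity), one_smul]

theorem ksVec_mem_sectionDomain (i : Fin 2) {z : ℍ[ℝ] × ℍ[ℝ]} (hz : z ∈ zeroLevel i) :
    ksVec i z ∈ sectionDomain i z.1 := by
  have hN : 0 < ⟪z.1, z.1⟫ := real_inner_self_pos.2 hz.1
  simp only [sectionDomain, mem_ofPred_eq, ksVec, norm_bil_self, inner_bil_self]
  positivity

theorem localSection_ksVec (i : Fin 2) {z : ℍ[ℝ] × ℍ[ℝ]} (hz : z ∈ zeroLevel i) :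
    localSection i z.1 (ksVec i z) = z := by
  have hN : 0 < ⟪z.1, z.1⟫ := real_inner_self_pos.2 hz.1
  have h1 : (localSection i z.1 (ksVec i z)).1 = z.1 := by
    simp only [localSection, ksVec, norm_bil_self, inner_bil_self, adj_bil, inner_twist_self,
      zero_smul, sub_zero]
    rw [show 2 * (⟪z.1, z.1⟫ * ⟪z.1, z.1⟫ + ⟪z.1, z.1⟫ ^ 2) = (2 * ⟪z.1, z.1⟫) ^ 2 by ring,
      Real.sqrt_sq (by positivity), ← add_smul, smul_smul, ← two_mul,
      inv_mul_cancel₀ (by positivity), one_smul]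
  refine Prod.ext h1 ?_
  rw [snd_eq_of_mem_zeroLevel i hz]
  conv_rhs => rw [← h1]
  rfl

theorem isOpen_sectionDomain (i : Fin 2) (q₀ : ℍ[ℝ]) : IsOpen (sectionDomain i q₀) := by
  apply isOpen_lt <;> fun_prop

theorem fst_ne_zero_of_mem_sectionDomain (i : Fin 2) {q₀ : ℍ[ℝ]} {w : Phase3}
    (hw : w ∈ sectionDomain i q₀) : w.1 ≠ 0 := by
  intro h
  simp [sectionDomain, h] at hw

theorem contDiffOn_localSection (i : Fin 2) (q₀ : ℍ[ℝ]) :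
    ContDiffOn ℝ ∞ (localSection i q₀) (sectionDomain i q₀) := by
  intro w hw
  apply ContDiffAt.contDiffWithinAt
  have h0 := fst_ne_zero_of_mem_sectionDomain i hw
  have hn : ContDiffAt ℝ ∞ (fun w : Phase3 => ‖w.1‖) w := contDiffAt_fst.norm ℝ h0
  have hi : ContDiffAt ℝ ∞ (fun w : Phase3 => ⟪bil i q₀ q₀, w.1⟫) w :=
    contDiffAt_const.inner ℝ contDiffAt_fst
  have hD : 0 < 2 * (‖w.1‖ * ⟪q₀, q₀⟫ + ⟪bil i q₀ q₀, w.1⟫) := mul_pos two_pos hw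
  have hs : ContDiffAt ℝ ∞
      (fun w : Phase3 => (√(2 * (‖w.1‖ * ⟪q₀, q₀⟫ + ⟪bil i q₀ q₀, w.1⟫)))⁻¹) w :=
    ((contDiffAt_const.mul ((hn.mul contDiffAt_const).add hi)).sqrt hD.ne').inv
      (Real.sqrt_pos.2 hD).ne'
  have hq : ContDiffAt ℝ ∞ (fun w => (localSection i q₀ w).1) w :=
    hs.smul ((hn.smul contDiffAt_const).add ((adj i q₀).contDiff.contDiffAt.comp w contDiffAt_fst))
  refine hq.prodMk (ContDiffAt.const_smul (2 : ℝ) ?_)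
  exact ((adj i).contDiff.contDiffAt.comp w hq).clm_apply contDiffAt_snd

theorem exists_mem_sectionDomain (i : Fin 2) {w : Phase3} (hw : w.1 ≠ 0) :
    ∃ q₀ : ℍ[ℝ], w ∈ sectionDomain i q₀ := by
  -- B(1, 1) and B(i, i) are opposite unit vectors, so x cannot lie on the excluded ray of both.
  by_contra! h
  have h1 := h (quat 1 0 0 0)
  have h2 := h (quat 0 1 0 0)
  have hpos := norm_pos_iff.2 hw
  simp only [sectionDomain, mem_ofPred_eq, not_lt, inner_quaternion_eq,
    inner_euclidean_three_eq] at h1 h2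
  fin_cases i <;> simp [bil_zero_apply, bil_one_apply] at h1 h2 <;> linarith

/-! ### Differentials and the symplectic form -/

theorem contDiff_Xi (i : Fin 2) : ContDiff ℝ ∞ (Xi i) := by
  have h : Xi i = fun z => -⟪twist i z.1, z.2⟫ := funext (Xi_eq_inner i)
  rw [h]
  exact (((twist i).contDiff.comp contDiff_fst).inner ℝ contDiff_snd).neg

theorem fderiv_Xi_apply (i : Fin 2) (z v : ℍ[ℝ] × ℍ[ℝ]) :
    fderiv ℝ (Xi i) z v = -(⟪twist i v.1, z.2⟫ + ⟪twist i z.1, v.2⟫) := by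
  have h : Xi i = fun z => -⟪twist i z.1, z.2⟫ := funext (Xi_eq_inner i)
  have h1 : HasFDerivAt (fun z : ℍ[ℝ] × ℍ[ℝ] => twist i z.1)
      ((twist i).comp (ContinuousLinearMap.fst ℝ ℍ[ℝ] ℍ[ℝ])) z :=
    (twist i).hasFDerivAt.comp z hasFDerivAt_fst
  rw [h, (h1.inner ℝ hasFDerivAt_snd).fun_neg.fderiv]
  simp [add_comm]

theorem mem_levelTangent_iff (i : Fin 2) (z v : ℍ[ℝ] × ℍ[ℝ]) :
    v ∈ levelTangent i z ↔ ⟪twist i v.1, z.2⟫ + ⟪twist i z.1, v.2⟫ = 0 := by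
  rw [levelTangent, LinearMap.mem_ker]
  change fderiv ℝ (Xi i) z v = 0 ↔ _
  rw [fderiv_Xi_apply, neg_eq_zero]

theorem fderiv_Xi_ne_zero (i : Fin 2) {z : ℍ[ℝ] × ℍ[ℝ]} (hz : z.1 ≠ 0) :
    fderiv ℝ (Xi i) z ≠ 0 := by
  intro h
  -- In the direction (0, Jq) the derivative of Ξ is -|q|².
  have h1 := fderiv_Xi_apply i z (0, twist i z.1)
  rw [h] at h1
  simp only [map_zero, inner_zero_left, inner_twist_twist, zero_add] at h1
  exact hz (inner_self_eq_zero.1 (neg_eq_zero.1 h1.symm))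

theorem contDiffAt_ksVec (i : Fin 2) {z : ℍ[ℝ] × ℍ[ℝ]} (hz : z.1 ≠ 0) :
    ContDiffAt ℝ ∞ (ksVec i) z := by
  have hN : 2 * ⟪z.1, z.1⟫ ≠ 0 := mul_ne_zero two_ne_zero (inner_self_ne_zero.2 hz)
  have h1 : ContDiffAt ℝ ∞ (fun z : ℍ[ℝ] × ℍ[ℝ] => bil i z.1) z := by
    fun_prop
  exact (h1.clm_apply contDiffAt_fst).prodMk
    (((contDiffAt_const.mul (contDiffAt_fst.inner ℝ contDiffAt_fst)).inv hN).smul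
      (h1.clm_apply contDiffAt_snd))

theorem fderiv_ksVec_apply (i : Fin 2) {z : ℍ[ℝ] × ℍ[ℝ]} (hz : z.1 ≠ 0) (v : ℍ[ℝ] × ℍ[ℝ]) :
    fderiv ℝ (ksVec i) z v = ((2 : ℝ) • bil i z.1 v.1,
      (2 * ⟪z.1, z.1⟫)⁻¹ • (bil i v.1 z.2 + bil i z.1 v.2)
        - (⟪z.1, v.1⟫ / ⟪z.1, z.1⟫ ^ 2) • bil i z.1 z.2) := by
  have hN' : ⟪z.1, z.1⟫ ≠ 0 := inner_self_ne_zero.2 hz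
  have hN : 2 * ⟪z.1, z.1⟫ ≠ 0 := mul_ne_zero two_ne_zero hN'
  have h1 : HasFDerivAt (fun z : ℍ[ℝ] × ℍ[ℝ] => bil i z.1)
      ((bil i).comp (ContinuousLinearMap.fst ℝ ℍ[ℝ] ℍ[ℝ])) z :=
    ((bil i).comp (ContinuousLinearMap.fst ℝ ℍ[ℝ] ℍ[ℝ])).hasFDerivAt
  have h2 := (hasFDerivAt_fst (𝕜 := ℝ) (p := z)).inner ℝ (hasFDerivAt_fst (𝕜 := ℝ) (p := z))
  have h3 := (hasDerivAt_inv hN).comp_hasFDerivAt z (h2.const_mul 2)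
  have h4 := (h1.clm_apply hasFDerivAt_fst).prodMk (h3.smul (h1.clm_apply hasFDerivAt_snd))
  have h5 : HasFDerivAt (ksVec i) _ z := h4
  rw [h5.fderiv]
  refine Prod.ext ?_ ?_
  · simp [bil_comm i v.1 z.1, two_smul]
  · simp only [ContinuousLinearMap.prod_apply, add_apply, smul_apply,
      ContinuousLinearMap.comp_apply, ContinuousLinearMap.flip_apply,
      ContinuousLinearMap.smulRight_apply, fderivInnerCLM_apply, Function.comp_apply,
      ContinuousLinearMap.coe_fst', ContinuousLinearMap.coe_snd', real_inner_comm z.1 v.1,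
      smul_eq_mul]
    match_scalars <;> field_simp
    ring

/-- By `inner_bil_bil` and `inner_bil_bil_sub` the pullback is Ω plus terms in Jq. The constraint
⟨Jq, p⟩ = 0 removes some of them, and the tangency equations ⟨Ja, p⟩ + ⟨Jq, b⟩ = 0 cancel the
others. -/
theorem stdForm_fderiv_ksVec (i : Fin 2) {z : ℍ[ℝ] × ℍ[ℝ]} (hz : z ∈ zeroLevel i)
    {v w : ℍ[ℝ] × ℍ[ℝ]} (hv : v ∈ levelTangent i z) (hw : w ∈ levelTangent i z) :
    stdForm (fderiv ℝ (ksVec i) z v) (fderiv ℝ (ksVec i) z w) = stdForm v w := by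
  have hN : ⟪z.1, z.1⟫ ≠ 0 := inner_self_ne_zero.2 hz.1
  have hX : ⟪twist i z.1, z.2⟫ = 0 := by
    have := hz.2
    rw [Xi_eq_inner] at this
    linarith
  rw [mem_levelTangent_iff] at hv hw
  rw [fderiv_ksVec_apply i hz.1, fderiv_ksVec_apply i hz.1]
  obtain ⟨q, p⟩ := z
  obtain ⟨a, b⟩ := v
  obtain ⟨a', b'⟩ := w
  have key := inner_bil_bil_sub i q p a a'
  have e1 := inner_bil_bil i q a b'
  have e2 := inner_bil_bil i q a' b
  have e3 := inner_bil_bil i q a p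
  have e4 := inner_bil_bil i q a' p
  simp only [stdForm, inner_sub_right, inner_sub_left, inner_add_left, inner_add_right,
    real_inner_smul_left, real_inner_smul_right] at *
  rw [real_inner_comm (bil i q a') (bil i a p), real_inner_comm (bil i q a') (bil i q b),
    real_inner_comm (bil i q a') (bil i q p), real_inner_comm a' b]
  rw [hX, mul_zero, sub_zero] at e3 e4
  rw [hX, mul_zero, zero_mul, add_zero] at key
  rw [e1, e2, e3, e4]
  field_simp
  linear_combination key + ⟪twist i q, a'⟫ * hv - ⟪twist i q, a⟫ * hw

theorem localSection_hasFDerivAt (i : Fin 2) {z : ℍ[ℝ] × ℍ[ℝ]} (hz : z ∈ zeroLevel i) :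
    HasFDerivAt (localSection i z.1) (fderiv ℝ (localSection i z.1) (ksVec i z)) (ksVec i z) :=
  (((contDiffOn_localSection i z.1).contDiffAt
    ((isOpen_sectionDomain i z.1).mem_nhds (ksVec_mem_sectionDomain i hz))).differentiableAt
      (by simp)).hasFDerivAt

theorem fderiv_localSection_mem (i : Fin 2) {z : ℍ[ℝ] × ℍ[ℝ]} (hz : z ∈ zeroLevel i)
    (ξ : Phase3) : fderiv ℝ (localSection i z.1) (ksVec i z) ξ ∈ levelTangent i z := by
  have h1 : HasFDerivAt (Xi i) (fderiv ℝ (Xi i) z) (localSection i z.1 (ksVec i z)) := by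
    rw [localSection_ksVec i hz]
    exact ((contDiff_Xi i).differentiable (by simp) z).hasFDerivAt
  have h2 := h1.comp _ (localSection_hasFDerivAt i hz)
  have h3 : Xi i ∘ localSection i z.1 =ᶠ[𝓝 (ksVec i z)] fun _ => 0 := by
    filter_upwards [(isOpen_sectionDomain i z.1).mem_nhds (ksVec_mem_sectionDomain i hz)] with w hw
    exact (localSection_mem_zeroLevel i hw).2
  have h4 := h2.unique ((hasFDerivAt_const (0 : ℝ) _).congr_of_eventuallyEq h3)
  exact LinearMap.mem_ker.2 (DFunLike.congr_fun h4 ξ)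

theorem fderiv_ksVec_fderiv_localSection (i : Fin 2) {z : ℍ[ℝ] × ℍ[ℝ]} (hz : z ∈ zeroLevel i)
    (ξ : Phase3) :
    fderiv ℝ (ksVec i) z (fderiv ℝ (localSection i z.1) (ksVec i z) ξ) = ξ := by
  have h1 : HasFDerivAt (ksVec i) (fderiv ℝ (ksVec i) z) (localSection i z.1 (ksVec i z)) := by
    rw [localSection_ksVec i hz]
    exact ((contDiffAt_ksVec i hz.1).differentiableAt (by simp)).hasFDerivAt
  have h2 := h1.comp _ (localSection_hasFDerivAt i hz)
  have h3 : ksVec i ∘ localSection i z.1 =ᶠ[𝓝 (ksVec i z)] id := by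
    filter_upwards [(isOpen_sectionDomain i z.1).mem_nhds (ksVec_mem_sectionDomain i hz)] with w hw
    exact ksVec_localSection i hw
  have h4 := h2.unique ((hasFDerivAt_id _).congr_of_eventuallyEq h3)
  exact DFunLike.congr_fun h4 ξ

theorem stdForm_fderiv_localSection (i : Fin 2) {z : ℍ[ℝ] × ℍ[ℝ]} (hz : z ∈ zeroLevel i)
    (ξ η : Phase3) :
    stdForm (fderiv ℝ (localSection i z.1) (ksVec i z) ξ)
      (fderiv ℝ (localSection i z.1) (ksVec i z) η) = stdForm ξ η := by
  rw [← stdForm_fderiv_ksVec i hz (fderiv_localSection_mem i hz ξ)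
    (fderiv_localSection_mem i hz η), fderiv_ksVec_fderiv_localSection i hz,
    fderiv_ksVec_fderiv_localSection i hz]

/-! ### Derivatives along the level -/

/-- A smooth retraction of `{q ≠ 0}` onto `J_0^i`. -/
def levelRetraction (i : Fin 2) (z : ℍ[ℝ] × ℍ[ℝ]) : ℍ[ℝ] × ℍ[ℝ] :=
  (z.1, z.2 + (Xi i z * ⟪z.1, z.1⟫⁻¹) • twist i z.1)

theorem levelRetraction_mem (i : Fin 2) {z : ℍ[ℝ] × ℍ[ℝ]} (hz : z.1 ≠ 0) :
    levelRetraction i z ∈ zeroLevel i := by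
  have hN : ⟪z.1, z.1⟫ ≠ 0 := inner_self_ne_zero.2 hz
  refine ⟨hz, ?_⟩
  simp only [Xi_eq_inner, levelRetraction, inner_add_right, real_inner_smul_right,
    inner_twist_twist]
  field_simp
  ring

theorem levelRetraction_eq_self (i : Fin 2) {z : ℍ[ℝ] × ℍ[ℝ]} (hz : z ∈ zeroLevel i) :
    levelRetraction i z = z := by
  simp [levelRetraction, hz.2]

/-- The correction term carries the factor Ξ, so at points of the level its derivative is a multiple
of dΞ, which vanishes on tangent vectors. -/
theorem exists_hasFDerivAt_levelRetraction (i : Fin 2) {z : ℍ[ℝ] × ℍ[ℝ]} (hz : z ∈ zeroLevel i) :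
    ∃ D : ℍ[ℝ] × ℍ[ℝ] →L[ℝ] ℍ[ℝ] × ℍ[ℝ], HasFDerivAt (levelRetraction i) D z ∧
      ∀ v ∈ levelTangent i z, D v = v := by
  have hN : ⟪z.1, z.1⟫ ≠ 0 := inner_self_ne_zero.2 hz.1
  have h1 : HasFDerivAt (fun z : ℍ[ℝ] × ℍ[ℝ] => twist i z.1)
      ((twist i).comp (ContinuousLinearMap.fst ℝ ℍ[ℝ] ℍ[ℝ])) z :=
    (twist i).hasFDerivAt.comp z hasFDerivAt_fst
  have h2 := (hasFDerivAt_fst (𝕜 := ℝ) (p := z)).inner ℝ (hasFDerivAt_fst (𝕜 := ℝ) (p := z))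
  have h3 := (hasDerivAt_inv hN).comp_hasFDerivAt z h2
  have h4 := ((contDiff_Xi i).differentiable (by simp) z).hasFDerivAt.mul h3
  have h5 := (hasFDerivAt_fst (𝕜 := ℝ) (p := z)).prodMk
    ((hasFDerivAt_snd (𝕜 := ℝ) (p := z)).add (h4.smul h1))
  refine ⟨_, h5, fun v hv => ?_⟩
  have hv' : fderiv ℝ (Xi i) z v = 0 := hv
  simp [hv', hz.2]

/-- Composed with the retraction, f and g agree on a full neighbourhood. This makes the differential
of π independent of the chosen extension. -/
theorem fderiv_apply_eq_of_eq_on_zeroLevel (i : Fin 2) {z : ℍ[ℝ] × ℍ[ℝ]} (hz : z ∈ zeroLevel i)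
    {f g : ℍ[ℝ] × ℍ[ℝ] → Phase3} (hf : DifferentiableAt ℝ f z) (hg : DifferentiableAt ℝ g z)
    (h : ∀ᶠ w in 𝓝 z, w ∈ zeroLevel i → f w = g w) {v : ℍ[ℝ] × ℍ[ℝ]}
    (hv : v ∈ levelTangent i z) : fderiv ℝ f z v = fderiv ℝ g z v := by
  obtain ⟨D, hD, hDv⟩ := exists_hasFDerivAt_levelRetraction i hz
  have hr := levelRetraction_eq_self i hz
  have hf' : HasFDerivAt f (fderiv ℝ f z) (levelRetraction i z) := by
    rw [hr]; exact hf.hasFDerivAt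
  have hg' : HasFDerivAt g (fderiv ℝ g z) (levelRetraction i z) := by
    rw [hr]; exact hg.hasFDerivAt
  have hc : Tendsto (levelRetraction i) (𝓝 z) (𝓝 z) := by
    conv_rhs => rw [← hr]
    exact hD.continuousAt
  have he : f ∘ levelRetraction i =ᶠ[𝓝 z] g ∘ levelRetraction i := by
    filter_upwards [hc.eventually h, continuous_fst.continuousAt.eventually_ne hz.1] with w hw hw0
    exact hw (levelRetraction_mem i hw0)
  have h1 := (hf'.comp z hD).unique ((hg'.comp z hD).congr_of_eventuallyEq he)
  have h2 := DFunLike.congr_fun h1 v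
  simpa [hDv v hv] using h2

/-! ### Topology of the orbit space -/

/-- The map induced by `ksVec` on the orbit space. -/
def orbitMap (i : Fin 2) : OrbitSpace i → Phase3 :=
  Quotient.lift (fun z : zeroLevel i => ksVec i z) (by
    rintro z w ⟨α, h⟩
    rw [← h, ksVec_chi])

@[simp] theorem orbitMap_proj (i : Fin 2) (z : zeroLevel i) :
    orbitMap i (proj i z) = ksVec i z := rfl

theorem proj_surjective (i : Fin 2) : Function.Surjective (proj i) := Quotient.mk_surjective

theorem continuous_proj (i : Fin 2) : Continuous (proj i) := continuous_quotient_mk'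

theorem orbitMap_injective (i : Fin 2) : Function.Injective (orbitMap i) := by
  intro x y h
  obtain ⟨z, rfl⟩ := proj_surjective i x
  obtain ⟨w, rfl⟩ := proj_surjective i y
  exact Quotient.sound (exists_chi_eq_of_ksVec_eq i z.2 w.2 h)

theorem continuous_orbitMap (i : Fin 2) : Continuous (orbitMap i) := by
  refine Continuous.quotient_lift ?_ _
  refine continuous_iff_continuousAt.2 fun z => ?_
  exact (contDiffAt_ksVec i z.2.1).continuousAt.comp continuous_subtype_val.continuousAt

/-- A continuous section through z lifts every point near the image of z to a point of the level
near z, hence to an orbit in the given open set. -/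
theorem isOpenMap_orbitMap (i : Fin 2) : IsOpenMap (orbitMap i) := by
  intro O hO
  obtain ⟨V, hV, hVO⟩ := isOpen_induced_iff.1 (hO.preimage (continuous_proj i))
  rw [isOpen_iff_mem_nhds]
  rintro _ ⟨x, hx, rfl⟩
  obtain ⟨z, rfl⟩ := proj_surjective i x
  have hzV : (z : ℍ[ℝ] × ℍ[ℝ]) ∈ V := by
    have : z ∈ Subtype.val ⁻¹' V := by rw [hVO]; exact hx
    exact this
  have hc := (localSection_hasFDerivAt i z.2).continuousAt
  have hV' : V ∈ 𝓝 (localSection i (z : ℍ[ℝ] × ℍ[ℝ]).1 (ksVec i z)) := by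
    rw [localSection_ksVec i z.2]; exact hV.mem_nhds hzV
  filter_upwards [hc hV', (isOpen_sectionDomain i _).mem_nhds (ksVec_mem_sectionDomain i z.2)]
    with w hw hw'
  refine ⟨proj i ⟨_, localSection_mem_zeroLevel i hw'⟩, ?_, ksVec_localSection i hw'⟩
  have : (⟨_, localSection_mem_zeroLevel i hw'⟩ : zeroLevel i) ∈ proj i ⁻¹' O := by
    rw [← hVO]; exact hw
  exact this

theorem isOpenEmbedding_orbitMap (i : Fin 2) : Topology.IsOpenEmbedding (orbitMap i) :=
  .of_continuous_injective_isOpenMap (continuous_orbitMap i) (orbitMap_injective i)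
    (isOpenMap_orbitMap i)

theorem range_orbitMap (i : Fin 2) : range (orbitMap i) = {w | w.1 ≠ 0} := by
  ext w
  constructor
  · rintro ⟨x, rfl⟩
    obtain ⟨z, rfl⟩ := proj_surjective i x
    exact bil_self_ne_zero i z.2.1
  · intro hw
    obtain ⟨q₀, h⟩ := exists_mem_sectionDomain i hw
    exact ⟨proj i ⟨_, localSection_mem_zeroLevel i h⟩, ksVec_localSection i h⟩

instance nonempty_orbitSpace (i : Fin 2) : Nonempty (OrbitSpace i) :=
  ⟨proj i ⟨(1, 0), one_ne_zero, by simp [Xi]⟩⟩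

theorem orbitMap_fst_ne_zero (i : Fin 2) (x : OrbitSpace i) : (orbitMap i x).1 ≠ 0 := by
  have : orbitMap i x ∈ range (orbitMap i) := mem_range_self x
  rwa [range_orbitMap] at this

end KS

/-! ### Arbitrary reduced structures -/

/-- The inverse function theorem for a chart on a manifold: a homeomorphism onto an open set of the
model space is smooth where its inverse is smooth with invertible differential. -/
theorem OpenPartialHomeomorph.contMDiffAt_of_symm {E M : Type*} [NormedAddCommGroup E]
    [NormedSpace ℝ E] [CompleteSpace E] [TopologicalSpace M] [ChartedSpace E M]
    [IsManifold 𝓘(ℝ, E) ∞ M] (e : OpenPartialHomeomorph M E) {w : E} (hw : w ∈ e.target)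
    (h : ContMDiffAt 𝓘(ℝ, E) 𝓘(ℝ, E) ∞ e.symm w) (A : E ≃L[ℝ] E)
    (hA : HasMFDerivAt 𝓘(ℝ, E) 𝓘(ℝ, E) e.symm w (A : E →L[ℝ] E)) :
    ContMDiffAt 𝓘(ℝ, E) 𝓘(ℝ, E) ∞ e (e.symm w) := by
  set x := e.symm w with hx
  set c := chartAt E x with hc
  have hxc : x ∈ c.source := mem_chart_source E x
  have hex : e x = w := e.right_inv hw
  have hxe : x ∈ e.source := e.map_target hw
  -- In the chart c, the inverse of e becomes a map f of the model space, and the inverse of f is e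
  -- read in c.
  let f : OpenPartialHomeomorph E E := e.symm.trans c
  have hfw : w ∈ f.source := by simp [f, hw, ← hx, hxc]
  have hfa : f.symm (c x) = w := by
    change e (c.symm (c x)) = w
    rw [c.left_inv hxc, hex]
  have ha : c x ∈ f.target := f.map_source hfw
  have hd : HasFDerivAt f (A : E →L[ℝ] E) w := by
    have h1 := hA.2
    simp only [modelWithCornersSelf_coe, range_id] at h1
    exact hasFDerivWithinAt_univ.1 h1
  have hs : ContDiffAt ℝ ∞ f w := by
    have h1 := (contMDiffAt_iff.1 h).2
    simp only [modelWithCornersSelf_coe, range_id] at h1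
    exact contDiffWithinAt_univ.1 h1
  have key := f.contDiffAt_symm (n := ∞) (f₀' := A) ha (by rw [hfa]; exact hd)
    (by rw [hfa]; exact hs)
  refine contMDiffAt_iff.2 ⟨e.continuousAt hxe, ?_⟩
  have h4 : ContDiffWithinAt ℝ ∞ f.symm univ (c x) := key.contDiffWithinAt
  simp only [modelWithCornersSelf_coe, range_id]
  exact h4

namespace KS

theorem eq_zero_of_stdForm_eq_zero {F : Type*} [NormedAddCommGroup F] [InnerProductSpace ℝ F]
    {v : F × F} (h : ∀ w, stdForm v w = 0) : v = 0 := by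
  -- Pairing v with (-v₂, v₁) gives |v₁|² + |v₂|².
  have h1 := h (-v.2, v.1)
  simp only [stdForm, inner_neg_right, sub_neg_eq_add, real_inner_self_eq_norm_sq] at h1
  have h2 : ‖v.1‖ = 0 := by nlinarith [norm_nonneg v.1, norm_nonneg v.2]
  have h3 : ‖v.2‖ = 0 := by nlinarith [norm_nonneg v.1, norm_nonneg v.2]
  exact Prod.ext (norm_eq_zero.1 h2) (norm_eq_zero.1 h3)

/-- `orbitMap` as an open partial homeomorphism. -/
def orbitHomeo (i : Fin 2) : OpenPartialHomeomorph (OrbitSpace i) Phase3 :=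
  (isOpenEmbedding_orbitMap i).toOpenPartialHomeomorph (orbitMap i)

theorem orbitHomeo_symm_orbitMap (i : Fin 2) (x : OrbitSpace i) :
    (orbitHomeo i).symm (orbitMap i x) = x :=
  (orbitHomeo i).left_inv (mem_univ x)

theorem orbitHomeo_target (i : Fin 2) : (orbitHomeo i).target = {w | w.1 ≠ 0} := by
  rw [← range_orbitMap, orbitHomeo, Topology.IsOpenEmbedding.toOpenPartialHomeomorph_target]

theorem orbitMap_orbitHomeo_symm (i : Fin 2) {w : Phase3} (hw : w.1 ≠ 0) :
    orbitMap i ((orbitHomeo i).symm w) = w :=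
  (orbitHomeo i).right_inv (by rw [orbitHomeo_target]; exact hw)

theorem orbitHomeo_symm_ksVec (i : Fin 2) {z : ℍ[ℝ] × ℍ[ℝ]} (hz : z ∈ zeroLevel i) :
    (orbitHomeo i).symm (ksVec i z) = proj i ⟨z, hz⟩ :=
  orbitHomeo_symm_orbitMap i (proj i ⟨z, hz⟩)

section Reduced

variable {i : Fin 2} [ChartedSpace Phase3 (OrbitSpace i)]

/-- The value of a 2-form, with the tangent spaces identified with the model space. -/
def formAt (σ : ∀ x : OrbitSpace i, TangentSpace 𝓘(ℝ, Phase3) x [⋀^Fin 2]→L[ℝ] ℝ)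
    (x : OrbitSpace i) (a b : Phase3) : ℝ :=
  σ x ![a, b]

theorem IsSmoothExtension.apply_eq {z : zeroLevel i} {F : ℍ[ℝ] × ℍ[ℝ] → OrbitSpace i}
    (hF : IsSmoothExtension i z F) : F z = proj i z := by
  obtain ⟨U, -, hz, -, h⟩ := hF
  exact h z hz

theorem IsSmoothExtension.contMDiffAt {z : zeroLevel i} {F : ℍ[ℝ] × ℍ[ℝ] → OrbitSpace i}
    (hF : IsSmoothExtension i z F) :
    ContMDiffAt 𝓘(ℝ, ℍ[ℝ] × ℍ[ℝ]) 𝓘(ℝ, Phase3) ∞ F z := by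
  obtain ⟨U, hU, hz, h, -⟩ := hF
  exact h.contMDiffAt (hU.mem_nhds hz)

/-- The link between an unknown smooth structure and the explicit formulas: the section lands in the
level, where F is π. -/
theorem IsSmoothExtension.orbitHomeo_symm_eventuallyEq {z : zeroLevel i}
    {F : ℍ[ℝ] × ℍ[ℝ] → OrbitSpace i} (hF : IsSmoothExtension i z F) :
    (orbitHomeo i).symm =ᶠ[𝓝 (ksVec i z)]
      F ∘ localSection i (z : ℍ[ℝ] × ℍ[ℝ]).1 := by
  obtain ⟨U, hU, hz, -, h⟩ := hF
  have hc := (localSection_hasFDerivAt i z.2).continuousAt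
  have hU' : U ∈ 𝓝 (localSection i (z : ℍ[ℝ] × ℍ[ℝ]).1 (ksVec i z)) := by
    rw [localSection_ksVec i z.2]; exact hU.mem_nhds hz
  filter_upwards [hc hU', (isOpen_sectionDomain i _).mem_nhds (ksVec_mem_sectionDomain i z.2)]
    with w hw hw'
  rw [Function.comp_apply, h ⟨_, localSection_mem_zeroLevel i hw'⟩ hw]
  conv_lhs => rw [← ksVec_localSection i hw']
  exact orbitHomeo_symm_ksVec i _

variable {σ : ∀ x : OrbitSpace i, TangentSpace 𝓘(ℝ, Phase3) x [⋀^Fin 2]→L[ℝ] ℝ}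

theorem IsReducedSpace.contMDiffAt_orbitHomeo_symm (h : IsReducedSpace i σ) (z : zeroLevel i) :
    ContMDiffAt 𝓘(ℝ, Phase3) 𝓘(ℝ, Phase3) ∞ (orbitHomeo i).symm (ksVec i z) := by
  obtain ⟨F, hF⟩ := h.proj_smooth z
  have hs : ContMDiffAt 𝓘(ℝ, Phase3) 𝓘(ℝ, ℍ[ℝ] × ℍ[ℝ]) ∞
      (localSection i (z : ℍ[ℝ] × ℍ[ℝ]).1) (ksVec i z) :=
    ((contDiffOn_localSection i _).contDiffAt
      ((isOpen_sectionDomain i _).mem_nhds (ksVec_mem_sectionDomain i z.2))).contMDiffAt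
  refine ContMDiffAt.congr_of_eventuallyEq ?_ hF.orbitHomeo_symm_eventuallyEq
  refine ContMDiffAt.comp _ ?_ hs
  rw [localSection_ksVec i z.2]
  exact hF.contMDiffAt

/-- A is dF composed with the differential of the section. The latter maps into the tangent space of
the level and preserves the forms; on that space dF pulls σ back to Ω. -/
theorem IsReducedSpace.exists_hasMFDerivAt_orbitHomeo_symm (h : IsReducedSpace i σ)
    (z : zeroLevel i) : ∃ A : Phase3 →L[ℝ] Phase3,
      HasMFDerivAt 𝓘(ℝ, Phase3) 𝓘(ℝ, Phase3) (orbitHomeo i).symm (ksVec i z) A ∧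
      ∀ ξ η, formAt σ (proj i z) (A ξ) (A η) = stdForm ξ η := by
  obtain ⟨F, hF⟩ := h.proj_smooth z
  let B : ℍ[ℝ] × ℍ[ℝ] →L[ℝ] Phase3 := mfderiv 𝓘(ℝ, ℍ[ℝ] × ℍ[ℝ]) 𝓘(ℝ, Phase3) F z
  have h1 : HasMFDerivAt 𝓘(ℝ, ℍ[ℝ] × ℍ[ℝ]) 𝓘(ℝ, Phase3) F
      (localSection i (z : ℍ[ℝ] × ℍ[ℝ]).1 (ksVec i z)) B := by
    rw [localSection_ksVec i z.2]
    exact (hF.contMDiffAt.mdifferentiableAt (by simp)).hasMFDerivAt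
  have h2 := h1.comp _ (localSection_hasFDerivAt i z.2).hasMFDerivAt
  refine ⟨B.comp (fderiv ℝ (localSection i (z : ℍ[ℝ] × ℍ[ℝ]).1) (ksVec i z)),
    h2.congr_of_eventuallyEq hF.orbitHomeo_symm_eventuallyEq, fun ξ η => ?_⟩
  rw [← hF.apply_eq, ← stdForm_fderiv_localSection i z.2]
  exact h.proj_pullback z F hF _ (fderiv_localSection_mem i z.2 ξ) _
    (fderiv_localSection_mem i z.2 η)

/-- The differential of the inverse pulls σ back to the nondegenerate standard form, so it is
injective, hence invertible in finite dimension, and the inverse function theorem applies. -/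
theorem IsReducedSpace.contMDiff_orbitMap (h : IsReducedSpace i σ) :
    ContMDiff 𝓘(ℝ, Phase3) 𝓘(ℝ, Phase3) ∞ (orbitMap i) := by
  have := h.isManifold
  intro x
  obtain ⟨z, rfl⟩ := proj_surjective i x
  obtain ⟨D, hD, hσ⟩ := h.exists_hasMFDerivAt_orbitHomeo_symm z
  have hinj : Function.Injective (D : Phase3 →ₗ[ℝ] Phase3) := by
    refine (injective_iff_map_eq_zero _).2 fun ξ hξ => eq_zero_of_stdForm_eq_zero fun η => ?_
    have hξ' : D ξ = 0 := hξ
    rw [← hσ, hξ']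
    exact (σ (proj i z)).map_coord_zero (0 : Fin 2) rfl
  let A : Phase3 ≃L[ℝ] Phase3 := (LinearEquiv.ofInjectiveEndo _ hinj).toContinuousLinearEquiv
  have key := (orbitHomeo i).contMDiffAt_of_symm
    (by rw [orbitHomeo_target]; exact bil_self_ne_zero i z.2.1)
    (h.contMDiffAt_orbitHomeo_symm z) A
    (by rw [show (A : Phase3 →L[ℝ] Phase3) = D from rfl]; exact hD)
  rw [orbitHomeo_symm_ksVec i z.2] at key
  exact key

theorem IsReducedSpace.stdForm_mfderiv_orbitMap (h : IsReducedSpace i σ) (x : OrbitSpace i)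
    (ξ η : TangentSpace 𝓘(ℝ, Phase3) x) :
    stdForm (F := EuclideanSpace ℝ (Fin 3)) (mfderiv 𝓘(ℝ, Phase3) 𝓘(ℝ, Phase3) (orbitMap i) x ξ)
      (mfderiv 𝓘(ℝ, Phase3) 𝓘(ℝ, Phase3) (orbitMap i) x η) = σ x ![ξ, η] := by
  obtain ⟨z, rfl⟩ := proj_surjective i x
  obtain ⟨A, hA, hσ⟩ := h.exists_hasMFDerivAt_orbitHomeo_symm z
  have h2 := ((h.contMDiff_orbitMap (proj i z)).mdifferentiableAt (by simp)).hasMFDerivAt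
  have h3 := HasMFDerivAt.comp (proj i z) (g := (orbitHomeo i).symm) hA h2
  have h4 : (orbitHomeo i).symm ∘ orbitMap i = id := funext (orbitHomeo_symm_orbitMap i)
  rw [h4] at h3
  have h5 := hasMFDerivAt_unique h3 (hasMFDerivAt_id _)
  let B : Phase3 →L[ℝ] Phase3 := mfderiv 𝓘(ℝ, Phase3) 𝓘(ℝ, Phase3) (orbitMap i) (proj i z)
  have h6 : ∀ ζ : Phase3, A (B ζ) = ζ := fun ζ => DFunLike.congr_fun h5 ζ
  have h7 : ∀ a b : Phase3, stdForm (B a) (B b) = formAt σ (proj i z) a b := fun a b => by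
    rw [← hσ, h6, h6]
  exact h7 ξ η

/-- The diffeomorphism from the reduced space onto `T*ℝ³₀` induced by the `KS` map. -/
def IsReducedSpace.diffeomorph (h : IsReducedSpace i σ) :
    OrbitSpace i ≃ₘ^∞⟮𝓘(ℝ, Phase3), 𝓘(ℝ, Phase3)⟯ cotangentR30 where
  toFun x := ⟨orbitMap i x, orbitMap_fst_ne_zero i x⟩
  invFun w := (orbitHomeo i).symm w
  left_inv x := orbitHomeo_symm_orbitMap i x
  right_inv w := Subtype.ext (orbitMap_orbitHomeo_symm i w.2)
  contMDiff_toFun := by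
    intro x
    have h1 := contMDiffAt_iff.1 (h.contMDiff_orbitMap x)
    exact contMDiffAt_iff.2
      ⟨((continuous_orbitMap i).subtype_mk (orbitMap_fst_ne_zero i)).continuousAt, h1.2⟩
  contMDiff_invFun := by
    intro w
    refine (contMDiffAt_subtype_iff (U := cotangentR30) (f := (orbitHomeo i).symm)).2 ?_
    -- Smoothness of the inverse is known at images of points of the level, so w is written as such
    -- an image.
    obtain ⟨z, hz⟩ := proj_surjective i ((orbitHomeo i).symm w)
    have : ksVec i z = w := by
      rw [← orbitMap_orbitHomeo_symm i w.2, ← hz, orbitMap_proj]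
    rw [← this]
    exact h.contMDiffAt_orbitHomeo_symm z

end Reduced

/-! ### Existence of the reduced structure -/

/-- The standard symplectic form on `ℝ³ × ℝ³` as an alternating map. -/
def stdAlternating : Phase3 [⋀^Fin 2]→L[ℝ] ℝ where
  toFun v := stdForm (v 0) (v 1)
  map_update_add' := by
    intro _ m j a b
    fin_cases j <;> simp [stdForm, Function.update, inner_add_left, inner_add_right] <;> ring
  map_update_smul' := by
    intro _ m j c a
    fin_cases j <;> simp [stdForm, Function.update, real_inner_smul_left, real_inner_smul_right] <;>
      ring
  cont := by
    simp only [stdForm]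
    fun_prop
  map_eq_zero_of_eq' := by
    intro v j k h hjk
    have h01 : v 0 = v 1 := by
      fin_cases j <;> fin_cases k <;> simp_all
    simp [stdForm, h01, real_inner_comm]

/-- The manifold structure on the orbit space with the single chart `orbitMap`. -/
abbrev orbitChartedSpace (i : Fin 2) : ChartedSpace Phase3 (OrbitSpace i) :=
  (isOpenEmbedding_orbitMap i).singletonChartedSpace

section Existence

attribute [local instance] orbitChartedSpace

variable (i : Fin 2)

theorem isManifold_orbitSpace : IsManifold 𝓘(ℝ, Phase3) ∞ (OrbitSpace i) :=
  (isOpenEmbedding_orbitMap i).isManifold_singleton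

/-- Since `orbitMap` is the only chart, its coordinate expression is the identity. -/
theorem hasMFDerivAt_orbitMap (x : OrbitSpace i) :
    HasMFDerivAt 𝓘(ℝ, Phase3) 𝓘(ℝ, Phase3) (orbitMap i) x (ContinuousLinearMap.id ℝ Phase3) := by
  refine ⟨(continuous_orbitMap i).continuousAt, ?_⟩
  refine HasFDerivAt.hasFDerivWithinAt ?_
  refine (hasFDerivAt_id (𝕜 := ℝ) (orbitMap i x)).congr_of_eventuallyEq ?_
  filter_upwards [(isOpenEmbedding_orbitMap i).isOpen_range.mem_nhds (mem_range_self x)] with w hw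
  rw [range_orbitMap] at hw
  exact orbitMap_orbitHomeo_symm i hw

theorem hasMFDerivAt_orbitHomeo_symm {w : Phase3} (hw : w ∈ (orbitHomeo i).target) :
    HasMFDerivAt 𝓘(ℝ, Phase3) 𝓘(ℝ, Phase3) (orbitHomeo i).symm w
      (ContinuousLinearMap.id ℝ Phase3) := by
  refine ⟨(orbitHomeo i).continuousAt_symm hw, ?_⟩
  refine HasFDerivAt.hasFDerivWithinAt ?_
  refine (hasFDerivAt_id (𝕜 := ℝ) w).congr_of_eventuallyEq ?_
  filter_upwards [(orbitHomeo i).open_target.mem_nhds hw] with u hu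
  exact (orbitHomeo i).right_inv hu

theorem localForm_stdAlternating {u : Phase3} (hu : u ∈ (orbitHomeo i).target) :
    localForm (M := OrbitSpace i) (fun _ => stdAlternating) (orbitHomeo i) u = stdAlternating := by
  have h : (mfderiv 𝓘(ℝ, Phase3) 𝓘(ℝ, Phase3) (orbitHomeo i).symm u : Phase3 →L[ℝ] Phase3) =
      ContinuousLinearMap.id ℝ Phase3 := (hasMFDerivAt_orbitHomeo_symm i hu).mfderiv
  exact congrArg (fun A : Phase3 →L[ℝ] Phase3 => stdAlternating.compContinuousLinearMap A) h

theorem isSymplecticForm_stdAlternating :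
    IsSymplecticForm (M := OrbitSpace i) (fun _ => stdAlternating) where
  smooth e he := by
    obtain rfl : e = orbitHomeo i :=
      OpenPartialHomeomorph.singletonChartedSpace_mem_atlas_eq _ _ _ he
    exact contDiffOn_const.congr fun u hu => localForm_stdAlternating i hu
  closed e he u hu := by
    obtain rfl : e = orbitHomeo i :=
      OpenPartialHomeomorph.singletonChartedSpace_mem_atlas_eq _ _ _ he
    have h : localForm (M := OrbitSpace i) (fun _ => stdAlternating) (orbitHomeo i) =ᶠ[𝓝 u]
        fun _ => stdAlternating := by
      filter_upwards [(orbitHomeo i).open_target.mem_nhds hu] with w hw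
      exact localForm_stdAlternating i hw
    -- In the single chart the form has constant coefficients, so its exterior derivative vanishes.
    rw [extDeriv, h.fderiv_eq, fderiv_fun_const]
    exact map_zero (ContinuousAlternatingMap.alternatizeUncurryFinCLM ℝ Phase3 ℝ)
  nondegenerate x ξ h := eq_zero_of_stdForm_eq_zero (v := (ξ : Phase3)) h

theorem isSmoothExtension_orbitHomeo_symm_comp_ksVec (z : zeroLevel i) :
    IsSmoothExtension i z ((orbitHomeo i).symm ∘ ksVec i) := by
  refine ⟨{z | z.1 ≠ 0}, isOpen_ne_fun continuous_fst continuous_const, z.2.1, ?_,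
    fun w _ => orbitHomeo_symm_ksVec i w.2⟩
  refine (contMDiffOn_isOpenEmbedding_symm (isOpenEmbedding_orbitMap i)).comp
    (t := range (orbitMap i)) (ContDiffOn.contMDiffOn fun z hz =>
      (contDiffAt_ksVec i hz).contDiffWithinAt) fun z hz => ?_
  rw [range_orbitMap]
  exact bil_self_ne_zero i hz

/-- In the single chart F is `orbitMap i ∘ F`, which agrees with `ksVec i` on the level near z, so
their derivatives agree on its tangent vectors. -/
theorem mfderiv_smoothExtension_apply {z : zeroLevel i} {F : ℍ[ℝ] × ℍ[ℝ] → OrbitSpace i}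
    (hF : IsSmoothExtension i z F) {v : ℍ[ℝ] × ℍ[ℝ]} (hv : v ∈ levelTangent i z) :
    (mfderiv 𝓘(ℝ, ℍ[ℝ] × ℍ[ℝ]) 𝓘(ℝ, Phase3) F z v : Phase3) = fderiv ℝ (ksVec i) z v := by
  let B : ℍ[ℝ] × ℍ[ℝ] →L[ℝ] Phase3 := mfderiv 𝓘(ℝ, ℍ[ℝ] × ℍ[ℝ]) 𝓘(ℝ, Phase3) F z
  have h1 : HasMFDerivAt 𝓘(ℝ, ℍ[ℝ] × ℍ[ℝ]) 𝓘(ℝ, Phase3) F z B :=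
    (hF.contMDiffAt.mdifferentiableAt (by simp)).hasMFDerivAt
  have h2 : HasFDerivAt (orbitMap i ∘ F) B (z : ℍ[ℝ] × ℍ[ℝ]) :=
    ((hasMFDerivAt_orbitMap i (F z)).comp _ h1).hasFDerivAt
  obtain ⟨U, hU, hz, -, h⟩ := hF
  rw [← fderiv_apply_eq_of_eq_on_zeroLevel i z.2 h2.differentiableAt
    ((contDiffAt_ksVec i z.2.1).differentiableAt (by simp)) ?_ hv, h2.fderiv]
  · rfl
  · filter_upwards [hU.mem_nhds hz] with w hw hw'
    rw [Function.comp_apply, h ⟨w, hw'⟩ hw, orbitMap_proj]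

theorem isReducedSpace_stdAlternating : IsReducedSpace i (fun _ => stdAlternating) where
  isManifold := isManifold_orbitSpace i
  isSymplecticForm := isSymplecticForm_stdAlternating i
  proj_smooth z := ⟨_, isSmoothExtension_orbitHomeo_symm_comp_ksVec i z⟩
  proj_submersion z F hF ξ := by
    refine ⟨_, fderiv_localSection_mem i z.2 ξ, ?_⟩
    exact (mfderiv_smoothExtension_apply i hF (fderiv_localSection_mem i z.2 ξ)).trans
      (fderiv_ksVec_fderiv_localSection i z.2 ξ)
  proj_pullback z F hF v hv w hw := by
    refine Eq.trans ?_ (stdForm_fderiv_ksVec i z.2 hv hw)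
    rw [← mfderiv_smoothExtension_apply i hF hv, ← mfderiv_smoothExtension_apply i hF hw]
    rfl

end Existence

end KS

end

end

open KS
theorem mainTheorem3 (i : Fin 2) :
    -- the level is invariant, and the `KS` map is constant on the orbits in it
    (∀ z ∈ zeroLevel i, ∀ α : Real.Angle,
      chi i α z ∈ zeroLevel i ∧ ksMap i (chi i α z) = ksMap i z) ∧
    -- the reduction is regular: the action is free and `0` is a regular value
    (∀ z ∈ zeroLevel i, fderiv ℝ (Xi i) z ≠ 0 ∧ ∀ α : Real.Angle, chi i α z = z → α = 0) ∧
    -- the reduced space exists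
    (∃ (cs : ChartedSpace Phase3 (OrbitSpace i))
      (σ : ∀ x : OrbitSpace i, TangentSpace 𝓘(ℝ, Phase3) x [⋀^Fin 2]→L[ℝ] ℝ),
      IsReducedSpace i σ) ∧
    -- the `KS` map induces a symplectomorphism from it onto `T*ℝ³₀`
    (∀ (cs : ChartedSpace Phase3 (OrbitSpace i))
      (σ : ∀ x : OrbitSpace i, TangentSpace 𝓘(ℝ, Phase3) x [⋀^Fin 2]→L[ℝ] ℝ),
      IsReducedSpace i σ →
      ∃ Φ : OrbitSpace i ≃ₘ^∞⟮𝓘(ℝ, Phase3), 𝓘(ℝ, Phase3)⟯ cotangentR30,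
        (∀ z : zeroLevel i,
          (embedR3 i (Φ (proj i z) : Phase3).1, embedR3 i (Φ (proj i z) : Phase3).2)
            = ksMap i z) ∧
        ∀ (x : OrbitSpace i) (ξ η : TangentSpace 𝓘(ℝ, Phase3) x),
          stdForm (mfderiv 𝓘(ℝ, Phase3) 𝓘(ℝ, Phase3) (fun y => (Φ y : Phase3)) x ξ)
              (mfderiv 𝓘(ℝ, Phase3) 𝓘(ℝ, Phase3) (fun y => (Φ y : Phase3)) x η)
            = σ x ![ξ, η]) := by
  refine ⟨fun z hz α => ⟨chi_mem_zeroLevel i α hz, ?_⟩, fun z hz => ⟨fderiv_Xi_ne_zero i hz.1, ?_⟩,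
    ⟨orbitChartedSpace i, _, isReducedSpace_stdAlternating i⟩, fun cs σ h => ?_⟩
  · rw [ksMap_eq_embedR3 i hz, ksMap_eq_embedR3 i (chi_mem_zeroLevel i α hz), ksVec_chi]
  · exact fun α h => eq_zero_of_rot_eq_self i α hz.1 (congrArg Prod.fst h)
  · exact ⟨h.diffeomorph, fun z => (ksMap_eq_embedR3 i z.2).symm, h.stdForm_mfderiv_orbitMap⟩
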